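/- For $k\in\mathbb{N}_0$ let $h_k(x)=(-1)^k(2^k k!\,\sqrt{\pi})^{-1/2}e^{x^2/2}\frac{d^k}{dx^k}e^{-x^2}$ be the normalized Hermite functions on $\mathbb{R}$, and let $\log_+x=\log(1+|x|)$. For $0<s<\tfrac12$, $y>0$ and $x\in\mathbb{R}\setminus\{0\}$ put $$P_{s,y}(x)=\sqrt{1-\frac{2}{x^2}\Big(\frac{2s}{y}\log_+(\sqrt2\,x)\Big)^{\frac{2s}{1-2s}}},\qquad L_{s,y}(x)=(1-2s)\Big(\frac{2s}{y}\Big)^{\frac{2s}{1-2s}}\big(\log_+(\sqrt2\,x)\big)^{\frac1{1-2s}},$$ where the square root is read as $0$ if its argument is negative (this can only happen for $x$ in a bounded set). Let $\kappa>0$, $\beta\in\mathbb{R}$ and $0<s<\tfrac12$. Then: (1) For every $y>2^{\frac1{2s}-1}$ there is a constant $C>0$, depending only on $\kappa,\beta,s,y$, such that for all $x\in\mathbb{R}\setminus[-1,1]$ the series below converges and $$\sum_{n\ge1}\frac{e^{-\kappa y n^{1/(2s)}}}{n^\beta}|h_n(x)|^\kappa\le C\,|x|\,\big(\log_+(\sqrt2\,x)\big)^{-\frac{2s(\kappa/4+\beta)}{1-2s}}\,e^{-\kappa\left(\frac{x^2}{2}P_{s,y}(x)-L_{s,y}(x)\right)}.$$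 (2) For every $0<y\le2^{\frac1{2s}-1}$ there is a constant $C>0$, depending only on $\kappa,\beta,s,y$, such that for every continuous function $\theta:(0,2^{\frac1{2s}-1}]\to[0,1]$ with $\theta(r)\le\frac{(2r)^{2s}}{2}$ for all $r$, and for all $x\in\mathbb{R}\setminus[-1,1]$, the series below converges and $$\sum_{n\ge1}\frac{e^{-\kappa y n^{1/(2s)}}}{n^\beta}|h_n(x)|^\kappa\le C\,|x|\,\big(\log_+(\sqrt2\,x)\big)^{-\frac{2s(\kappa/4+\beta)}{1-2s}}\,e^{-\kappa\,\theta(y)^{1/(2s)}\left(\frac{x^2}{2}P_{s,y}(x)-L_{s,y}(x)\right)}.$$ -/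

import Mathlib

/-- The normalized Hermite function
`h_k(x) = (-1)^k (2^k k! √π)^{-1/2} e^{x²/2} (d/dx)^k e^{-x²}`. -/
noncomputable def hermiteFun (k : ℕ) (x : ℝ) : ℝ :=
  (-1) ^ k * (2 ^ k * (k.factorial : ℝ) * Real.sqrt Real.pi) ^ (-(1 / 2) : ℝ) *
    Real.exp (x ^ 2 / 2) * iteratedDeriv k (fun t : ℝ => Real.exp (-t ^ 2)) x

/-- `log₊ x = log (1 + |x|)`. -/
noncomputable def logPlus (x : ℝ) : ℝ := Real.log (1 + |x|)

/-- `P_{s,y}(x) = √(1 - (2/x²) ((2s/y) log₊(√2 x))^{2s/(1-2s)})`.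
Where the radicand is negative (which happens only for `x` in a bounded set) the value is `0`. -/
noncomputable def Psy (s y x : ℝ) : ℝ :=
  Real.sqrt (1 - 2 / x ^ 2 *
    (2 * s / y * logPlus (Real.sqrt 2 * x)) ^ (2 * s / (1 - 2 * s)))

/-- `L_{s,y}(x) = (1-2s) (2s/y)^{2s/(1-2s)} (log₊(√2 x))^{1/(1-2s)}`. -/
noncomputable def Lsy (s y x : ℝ) : ℝ :=
  (1 - 2 * s) * (2 * s / y) ^ (2 * s / (1 - 2 * s)) *
    logPlus (Real.sqrt 2 * x) ^ (1 / (1 - 2 * s))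

/-- The term `e^{-κ y n^{1/(2s)}} n^{-β} |h_n(x)|^κ` of the weighted sum. -/
noncomputable def hermiteTerm (κ β s y x : ℝ) (n : ℕ) : ℝ :=
  Real.exp (-κ * y * (n : ℝ) ^ (1 / (2 * s))) / (n : ℝ) ^ β * |hermiteFun n x| ^ κ

/-!
The estimate rests on three elementary facts.

* The three-term recurrence `H_{k+2} = 2x H_{k+1} - 2(k+1) H_k` of the physicists' Hermite
  polynomials gives `|H_k(x)| ≤ (2|x| + √(2k))^k` by induction. After normalization, and with
  `n! ≥ (n/e)^n`, the Hermite function `h_n(x)` is at most `e^{-x²/2}` times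
  `e^{n (log 2 + 1/2 - log n / 2)} · max (e^{ℓ}, √n)^n`, where `ℓ = log₊ (√2 x)`
  (`abs_hermiteFun_le_exp`).
* `L_{s,y}(x)` is the Legendre transform `sup_t (tℓ - y t^{1/(2s)})`, so Young's inequality gives
  `nℓ - y n^{1/(2s)} ≤ L_{s,y}(x)` (`mul_logPlus_le`). Hence the `n`-th term of the series is at
  most `e^{-κ(x²/2 - L)} u_n` with `u` summable and independent of `x`: if `e^ℓ` is the larger
  entry of the maximum, then `u_n` inherits the superexponential decay of `1/√n!`, and otherwise
  that of `e^{-κ y n^{1/(2s)}}`, because `1/(2s) > 1` (`hermiteTerm_le`, `summable_majorant`).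
* Every power of `ℓ` is `O(|x|)` on `|x| > 1` (`exists_logPlus_rpow_le`). So the prefactor
  `|x| ℓ^{-M}` is bounded below, and `x²/2 - L` is bounded below. Since `P ≤ 1`, for each
  `T ∈ [0, 1]` the quantity `T (x²/2 · P - L)` exceeds `x²/2 - L` by at most a constant that does
  not depend on `T` (`exists_exp_le`).

Together these bound the series for every `y > 0` and every `T ∈ [0, 1]` in front of the exponent;
the two regimes of `y` are the cases `T = 1` and `T = θ(y)^{1/(2s)}`.
-/

open Real Filter

/-! ### Hermite polynomials and functions -/

/-- The physicists' Hermite polynomials as functions on `ℝ`, defined by their three-term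
recurrence. -/
def hermiteH : ℕ → ℝ → ℝ
  | 0, _ => 1
  | 1, x => 2 * x
  | k + 2, x => 2 * x * hermiteH (k + 1) x - 2 * (k + 1) * hermiteH k x

theorem hasDerivAt_hermiteH (k : ℕ) (x : ℝ) :
    HasDerivAt (hermiteH (k + 1)) (2 * (k + 1) * hermiteH k x) x := by
  induction k using Nat.strong_induction_on with
  | _ k ih =>
    match k with
    | 0 => simpa [hermiteH] using (hasDerivAt_id x).const_mul (2 : ℝ)
    | 1 =>
      have h : HasDerivAt (fun t : ℝ => 2 * t * (2 * t) - 2 * (((0 : ℕ) : ℝ) + 1) * 1)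
          (2 * 1 * (2 * x) + 2 * x * (2 * 1)) x :=
        ((((hasDerivAt_id x).const_mul 2).mul ((hasDerivAt_id x).const_mul 2))).sub_const _
      refine HasDerivAt.congr_deriv (f' := 2 * 1 * (2 * x) + 2 * x * (2 * 1)) h ?_
      simp [hermiteH]; ring
    | k + 2 =>
      have h := (((hasDerivAt_id x).const_mul 2).mul (ih (k + 1) (by omega))).sub
        ((ih k (by omega)).const_mul (2 * (((k + 1 : ℕ) : ℝ) + 1)))
      refine HasDerivAt.congr_deriv h ?_
      simp only [hermiteH, id, Nat.cast_add, Nat.cast_one, Nat.cast_ofNat]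
      ring

theorem iteratedDeriv_gaussian (k : ℕ) :
    iteratedDeriv k (fun t : ℝ => exp (-t ^ 2)) =
      fun x => (-1) ^ k * (hermiteH k x * exp (-x ^ 2)) := by
  have hg (x : ℝ) : HasDerivAt (fun t : ℝ => exp (-t ^ 2)) (exp (-x ^ 2) * -(2 * x)) x := by
    simpa using ((hasDerivAt_pow 2 x).neg).exp
  induction k with
  | zero => simp [hermiteH]
  | succ k ih =>
    rw [iteratedDeriv_succ, ih]
    funext x
    match k with
    | 0 =>
      simp only [hermiteH, pow_zero, one_mul]
      rw [(hg x).deriv]; ring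
    | k + 1 =>
      have h : HasDerivAt (fun t => (-1) ^ (k + 1) * (hermiteH (k + 1) t * exp (-t ^ 2))) _ x :=
        ((hasDerivAt_hermiteH k x).mul (hg x)).const_mul _
      rw [h.deriv]
      simp only [hermiteH]; ring

theorem abs_hermiteH_le (k : ℕ) (x : ℝ) : |hermiteH k x| ≤ (2 * |x| + √(2 * k)) ^ k := by
  induction k using Nat.strong_induction_on with
  | _ k ih =>
    match k with
    | 0 => simp [hermiteH]
    | 1 =>
      have : 0 ≤ √(2 * ((1 : ℕ) : ℝ)) := sqrt_nonneg _
      simp only [hermiteH, abs_mul, pow_one, abs_two]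
      linarith
    | k + 2 =>
      -- With this `c`, the induction step amounts to `2(k+1) ≤ √(2(k+2)) · c`.
      set c := 2 * |x| + √(2 * ((k + 2 : ℕ) : ℝ)) with hc
      have hx := abs_nonneg x
      have hc0 : 0 ≤ c := by positivity
      have h1 : |hermiteH (k + 1) x| ≤ c ^ (k + 1) :=
        (ih (k + 1) (by omega)).trans (by rw [hc]; gcongr; omega)
      have h0 : |hermiteH k x| ≤ c ^ k :=
        (ih k (by omega)).trans (by rw [hc]; gcongr; omega)
      have hk : 2 * ((k : ℝ) + 1) ≤ √(2 * ((k + 2 : ℕ) : ℝ)) * c := by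
        have h := mul_self_sqrt (show (0 : ℝ) ≤ 2 * ((k + 2 : ℕ) : ℝ) by positivity)
        have h' : 0 ≤ √(2 * ((k + 2 : ℕ) : ℝ)) * (2 * |x|) := by positivity
        rw [hc, mul_add _ (2 * |x|), h]; push_cast at *; linarith
      calc |hermiteH (k + 2) x|
          ≤ 2 * |x| * |hermiteH (k + 1) x| + 2 * ((k : ℝ) + 1) * |hermiteH k x| := by
            refine (abs_sub _ _).trans (le_of_eq ?_)
            rw [abs_mul, abs_mul, abs_mul, abs_mul, abs_two,
              abs_of_nonneg (show (0 : ℝ) ≤ k + 1 by positivity)]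
        _ ≤ 2 * |x| * c ^ (k + 1) + √(2 * ((k + 2 : ℕ) : ℝ)) * c * c ^ k := by gcongr
        _ = c ^ (k + 2) := by rw [hc]; ring

theorem abs_hermiteFun_le (n : ℕ) (x : ℝ) :
    |hermiteFun n x| ≤ exp (-(x ^ 2 / 2)) * ((√2 * |x| + √n) ^ n / √(n.factorial)) := by
  have hpi : 1 ≤ √π := one_le_sqrt.2 (by linarith [pi_gt_three])
  have hf : (0 : ℝ) < n.factorial := by positivity
  have hnorm : (2 ^ n * (n.factorial : ℝ) * √π) ^ (-(1 / 2) : ℝ) ≤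
      (√2 ^ n)⁻¹ * (√(n.factorial))⁻¹ := by
    rw [rpow_neg (by positivity), ← sqrt_eq_rpow, sqrt_mul (by positivity),
      sqrt_mul (by positivity), ← mul_inv]
    have h2 : √((2 : ℝ) ^ n) = √2 ^ n := by
      rw [sqrt_eq_iff_mul_self_eq (by positivity) (by positivity), ← mul_pow,
        mul_self_sqrt (by norm_num)]
    rw [h2]
    apply inv_anti₀ (by positivity)
    exact le_mul_of_one_le_right (by positivity) (one_le_sqrt.2 hpi)
  have hH : |hermiteH n x| ≤ √2 ^ n * (√2 * |x| + √n) ^ n := by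
    refine (abs_hermiteH_le n x).trans (le_of_eq ?_)
    rw [← mul_pow, mul_add, ← mul_assoc, mul_self_sqrt (by norm_num), sqrt_mul (by norm_num)]
  have he : exp (x ^ 2 / 2) * exp (-x ^ 2) = exp (-(x ^ 2 / 2)) := by
    rw [← exp_add]; congr 1; ring
  rw [hermiteFun, iteratedDeriv_gaussian]
  simp only [abs_mul, abs_pow, abs_neg, abs_one, one_pow, one_mul, abs_exp]
  rw [abs_of_nonneg (by positivity)]
  calc (2 ^ n * (n.factorial : ℝ) * √π) ^ (-(1 / 2) : ℝ) * exp (x ^ 2 / 2) *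
        (|hermiteH n x| * exp (-x ^ 2))
      = (2 ^ n * (n.factorial : ℝ) * √π) ^ (-(1 / 2) : ℝ) * |hermiteH n x| *
          (exp (x ^ 2 / 2) * exp (-x ^ 2)) := by ring
    _ ≤ ((√2 ^ n)⁻¹ * (√(n.factorial))⁻¹) * (√2 ^ n * (√2 * |x| + √n) ^ n) *
          exp (-(x ^ 2 / 2)) := by rw [he]; gcongr
    _ = exp (-(x ^ 2 / 2)) * ((√2 * |x| + √n) ^ n / √(n.factorial)) := by
        field_simp

theorem logPlus_nonneg (x : ℝ) : 0 ≤ logPlus x :=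
  log_nonneg (by linarith [abs_nonneg x])

theorem exp_logPlus_sqrt_two_mul (x : ℝ) : exp (logPlus (√2 * x)) = 1 + √2 * |x| := by
  rw [logPlus, abs_mul, abs_of_nonneg (sqrt_nonneg 2), exp_log (by positivity)]

theorem abs_hermiteFun_le_exp {n : ℕ} (hn : 0 < n) (x : ℝ) :
    |hermiteFun n x| ≤ exp (-(x ^ 2 / 2) + n * (log 2 + 1 / 2 - log n / 2) +
      n * max (logPlus (√2 * x)) (log n / 2)) := by
  have hn' : (0 : ℝ) < n := by exact_mod_cast hn
  set m := max (logPlus (√2 * x)) (log n / 2) with hm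
  have hsq : √(n : ℝ) = exp (log n / 2) := by
    rw [exp_half, exp_log hn']
  have hbase : √2 * |x| + √n ≤ exp (log 2 + m) := by
    have h1 : √2 * |x| ≤ exp m :=
      le_trans (by rw [exp_logPlus_sqrt_two_mul]; linarith)
        (exp_le_exp.2 (le_max_left (logPlus (√2 * x)) (log n / 2)))
    have h2 : √n ≤ exp m := by
      rw [hsq]; exact exp_le_exp.2 (le_max_right _ _)
    rw [exp_add, exp_log two_pos]; linarith
  have hfact : exp (n * (log n / 2 - 1 / 2)) ≤ √(n.factorial) := by
    refine le_sqrt_of_sq_le ?_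
    have h := pow_div_factorial_le_exp (n : ℝ) hn'.le n
    rw [div_le_iff₀ (by positivity)] at h
    have : exp (n * (log n / 2 - 1 / 2)) ^ 2 = n ^ n * (exp n)⁻¹ := by
      rw [← exp_nat_mul, ← exp_neg]
      nth_rewrite 3 [← exp_log hn']
      rw [← exp_nat_mul, ← exp_add]
      congr 1; push_cast; ring
    rw [this, ← div_eq_mul_inv, div_le_iff₀ (exp_pos _)]
    linarith
  calc |hermiteFun n x| ≤ exp (-(x ^ 2 / 2)) * ((√2 * |x| + √n) ^ n / √(n.factorial)) :=
        abs_hermiteFun_le n x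
    _ ≤ exp (-(x ^ 2 / 2)) * (exp (log 2 + m) ^ n / exp (n * (log n / 2 - 1 / 2))) := by
        gcongr
    _ = _ := by
        rw [← exp_nat_mul, ← exp_sub, ← exp_add]
        congr 1; ring

/-! ### The summable majorant -/

/-- The `x`-independent majorant of the series: `n^{-β}` times the sum of the decay rates
`(2^n e^{n/2} n^{-n/2})^κ` and `(2^n e^{n/2} e^{-y n^{1/(2s)}})^κ`. -/
noncomputable def majorant (κ β s y : ℝ) (n : ℕ) : ℝ :=
  exp (κ * (n * (log 2 + 1 / 2 - log n / 2))) / (n : ℝ) ^ β +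
    exp (κ * (n * (log 2 + 1 / 2 - y * (n : ℝ) ^ (1 / (2 * s) - 1)))) / (n : ℝ) ^ β

theorem summable_exp_div_rpow {κ β c : ℝ} (hκ : 0 < κ) {g : ℕ → ℝ} (hg : Tendsto g atTop atTop) :
    Summable fun n : ℕ => exp (κ * (n * (c - g n))) / (n : ℝ) ^ β := by
  refine Summable.of_norm_bounded_eventually_nat summable_exp_neg_nat ?_
  filter_upwards [hg.eventually_ge_atTop (c + (|β| + 1) / κ), eventually_gt_atTop 0] with n hn h0
  have hn0 : (0 : ℝ) < n := by exact_mod_cast h0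
  have hlog : 0 ≤ log n := log_natCast_nonneg n
  have hlog' : log n ≤ n := (log_le_sub_one_of_pos hn0).trans (by linarith)
  rw [norm_of_nonneg (by positivity), rpow_def_of_pos hn0, ← exp_sub, exp_le_exp]
  have h1 : κ * (c - g n) ≤ -(|β| + 1) := by
    have : c - g n ≤ -((|β| + 1) / κ) := by linarith
    calc κ * (c - g n) ≤ κ * -((|β| + 1) / κ) := by gcongr
      _ = _ := by field_simp
  have h2 : -(log n * β) ≤ n * |β| := by
    calc -(log n * β) = log n * -β := by ring
      _ ≤ log n * |β| := by gcongr; exact neg_le_abs β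
      _ ≤ n * |β| := by gcongr
  have h3 : (n : ℝ) * (κ * (c - g n)) ≤ n * -(|β| + 1) := by gcongr
  linarith

theorem summable_majorant {κ s y : ℝ} (β : ℝ) (hκ : 0 < κ) (hs0 : 0 < s) (hs1 : s < 1 / 2)
    (hy : 0 < y) : Summable (majorant κ β s y) := by
  refine (summable_exp_div_rpow hκ ?_).add (summable_exp_div_rpow hκ ?_)
  · exact (tendsto_log_atTop.comp tendsto_natCast_atTop_atTop).atTop_div_const two_pos
  · have : 0 < 1 / (2 * s) - 1 := by
      rw [sub_pos, lt_div_iff₀ (by positivity)]; linarith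
    exact ((tendsto_rpow_atTop this).comp tendsto_natCast_atTop_atTop).const_mul_atTop hy

theorem Lsy_nonneg {s y : ℝ} (hs0 : 0 < s) (hs1 : s < 1 / 2) (hy : 0 < y) (x : ℝ) :
    0 ≤ Lsy s y x := by
  have : 0 < 1 - 2 * s := by linarith
  have := logPlus_nonneg (√2 * x)
  unfold Lsy; positivity

/-- Young's inequality with exponents `1/(2s)` and `1/(1-2s)`, in the form that identifies `L` as
an upper bound of `tℓ - y t^{1/(2s)}`. -/
theorem mul_logPlus_le {s y : ℝ} (hs0 : 0 < s) (hs1 : s < 1 / 2) (hy : 0 < y) (x : ℝ) {t : ℝ}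
    (ht : 0 ≤ t) :
    t * logPlus (√2 * x) ≤ y * t ^ (1 / (2 * s)) + Lsy s y x := by
  have h1 : 0 < 1 - 2 * s := by linarith
  have hl := logPlus_nonneg (√2 * x)
  -- The scaling by `r^{∓2s}` makes the first Young term equal to `y t^{1/(2s)}`.
  set r := 2 * s / y with hr
  have hr0 : 0 < r := by positivity
  have hconj : (1 / (2 * s)).HolderConjugate (1 / (1 - 2 * s)) := by
    rw [Real.holderConjugate_iff]
    constructor
    · rw [lt_div_iff₀ (by positivity)]; linarith
    · simp
  have h := young_inequality_of_nonneg (a := t * r ^ (-(2 * s)))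
    (b := logPlus (√2 * x) * r ^ (2 * s))
    (by positivity) (by positivity) hconj
  have hlhs : t * r ^ (-(2 * s)) * (logPlus (√2 * x) * r ^ (2 * s)) = t * logPlus (√2 * x) := by
    rw [rpow_neg hr0.le]; field_simp
  have hA : (t * r ^ (-(2 * s))) ^ (1 / (2 * s)) / (1 / (2 * s)) = y * t ^ (1 / (2 * s)) := by
    rw [mul_rpow ht (by positivity), ← rpow_mul hr0.le,
      show -(2 * s) * (1 / (2 * s)) = -1 by field_simp, rpow_neg_one, hr]
    field_simp
  have hB : (logPlus (√2 * x) * r ^ (2 * s)) ^ (1 / (1 - 2 * s)) / (1 / (1 - 2 * s)) =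
      Lsy s y x := by
    rw [mul_rpow hl (by positivity), ← rpow_mul hr0.le, mul_one_div, Lsy, div_div_eq_mul_div,
      div_one]
    ring
  rwa [hlhs, hA, hB] at h

theorem hermiteTerm_nonneg (κ β s y x : ℝ) (n : ℕ) : 0 ≤ hermiteTerm κ β s y x n := by
  unfold hermiteTerm; positivity

theorem hermiteTerm_le {κ s y : ℝ} (β : ℝ) (hκ : 0 < κ) (hs0 : 0 < s) (hs1 : s < 1 / 2)
    (hy : 0 < y) (x : ℝ) {n : ℕ} (hn : 0 < n) :
    hermiteTerm κ β s y x n ≤ exp (-κ * (x ^ 2 / 2 - Lsy s y x)) * majorant κ β s y n := by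
  have hn' : (0 : ℝ) < n := by exact_mod_cast hn
  set ℓ := logPlus (√2 * x)
  set E := -(x ^ 2 / 2) + n * (log 2 + 1 / 2 - log n / 2) + n * max ℓ (log n / 2)
    with hE
  have hterm : hermiteTerm κ β s y x n ≤
      exp (κ * (E - y * (n : ℝ) ^ (1 / (2 * s)))) / (n : ℝ) ^ β := by
    calc hermiteTerm κ β s y x n
        ≤ exp (-κ * y * (n : ℝ) ^ (1 / (2 * s))) / (n : ℝ) ^ β * exp E ^ κ := by
          unfold hermiteTerm
          gcongr
          exact abs_hermiteFun_le_exp hn x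
      _ = _ := by
          rw [← exp_mul, div_mul_eq_mul_div, ← exp_add]
          congr 2; ring
  refine hterm.trans ?_
  rw [majorant, mul_add, ← mul_div_assoc, ← mul_div_assoc, ← exp_add, ← exp_add]
  rcases le_total (log n / 2) ℓ with h | h
  · refine le_add_of_le_of_nonneg ?_ (by positivity)
    gcongr
    rw [hE, max_eq_left h]
    have := mul_logPlus_le hs0 hs1 hy x hn'.le
    have := mul_le_mul_of_nonneg_left this hκ.le
    linarith
  · refine le_add_of_nonneg_of_le (by positivity) ?_
    gcongr
    have hpow : (n : ℝ) ^ (1 / (2 * s)) = n * (n : ℝ) ^ (1 / (2 * s) - 1) := by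
      rw [rpow_sub_one hn'.ne']; field_simp
    rw [hE, max_eq_right h, hpow]
    have := mul_nonneg hκ.le (Lsy_nonneg hs0 hs1 hy x)
    linarith

/-! ### Comparison of the exponential factors -/

theorem exists_logPlus_rpow_le (q : ℝ) :
    ∃ C : ℝ, 0 < C ∧ ∀ x : ℝ, 1 < |x| → logPlus (√2 * x) ^ q ≤ C * |x| := by
  have hs : 1 ≤ √2 := one_le_sqrt.2 one_le_two
  have hlow {x : ℝ} (hx : 1 < |x|) : log 2 ≤ logPlus (√2 * x) := by
    rw [logPlus, abs_mul, abs_of_nonneg (sqrt_nonneg 2)]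
    exact log_le_log two_pos (by nlinarith)
  have hlog2 : 0 < log 2 := log_pos one_lt_two
  rcases le_or_gt q 0 with hq | hq
  · refine ⟨log 2 ^ q, by positivity, fun x hx => ?_⟩
    calc logPlus (√2 * x) ^ q ≤ log 2 ^ q := rpow_le_rpow_of_nonpos hlog2 (hlow hx) hq
      _ ≤ log 2 ^ q * |x| := le_mul_of_one_le_right (by positivity) hx.le
  · refine ⟨3 * q ^ q, by positivity, fun x hx => ?_⟩
    have hbase : 1 + |√2 * x| ≤ 3 * |x| := by
      rw [abs_mul, abs_of_nonneg (sqrt_nonneg 2)]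
      nlinarith [sqrt_le_sqrt (show (2 : ℝ) ≤ 4 by norm_num),
        show √(4 : ℝ) = 2 by rw [show (4 : ℝ) = 2 ^ 2 by norm_num]; exact sqrt_sq two_pos.le]
    have h0 : 0 ≤ 1 + |√2 * x| := by positivity
    calc logPlus (√2 * x) ^ q ≤ ((1 + |√2 * x|) ^ (1 / q) / (1 / q)) ^ q :=
          rpow_le_rpow (logPlus_nonneg _) (log_le_rpow_div h0 (by positivity)) hq.le
      _ = q ^ q * (1 + |√2 * x|) := by
          rw [div_div_eq_mul_div, div_one, mul_rpow (by positivity) hq.le, ← rpow_mul h0,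
            one_div_mul_cancel hq.ne', rpow_one, mul_comm]
      _ ≤ q ^ q * (3 * |x|) := by gcongr
      _ = 3 * q ^ q * |x| := by ring

theorem exists_Lsy_le {s y : ℝ} (hs1 : s < 1 / 2) (hs0 : 0 < s) (hy : 0 < y) :
    ∃ K : ℝ, ∀ x : ℝ, 1 < |x| → Lsy s y x ≤ x ^ 2 / 2 + K := by
  obtain ⟨C, -, h⟩ := exists_logPlus_rpow_le (1 / (1 - 2 * s))
  have h1 : 0 < 1 - 2 * s := by linarith
  set a := (1 - 2 * s) * (2 * s / y) ^ (2 * s / (1 - 2 * s)) with ha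
  refine ⟨(a * C) ^ 2 / 2, fun x hx => ?_⟩
  calc Lsy s y x ≤ a * (C * |x|) := mul_le_mul_of_nonneg_left (h x hx) (by positivity)
    _ ≤ x ^ 2 / 2 + (a * C) ^ 2 / 2 := by nlinarith [sq_nonneg (|x| - a * C), sq_abs x]

/-- `P ≤ 1` and the lower bound on `x²/2 - L` show that damping the exponent by a factor
`T ∈ [0, 1]` costs no more than a constant. -/
theorem exists_exp_le {κ s y : ℝ} (hκ : 0 < κ) (hs0 : 0 < s) (hs1 : s < 1 / 2) (hy : 0 < y) :
    ∃ C : ℝ, 0 < C ∧ ∀ T ∈ Set.Icc (0 : ℝ) 1, ∀ x : ℝ, 1 < |x| →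
      exp (-κ * (x ^ 2 / 2 - Lsy s y x)) ≤
        C * exp (-κ * T * (x ^ 2 / 2 * Psy s y x - Lsy s y x)) := by
  obtain ⟨K, hK⟩ := exists_Lsy_le hs1 hs0 hy
  refine ⟨exp (κ * |K|), exp_pos _, fun T hT x hx => ?_⟩
  have hP : Psy s y x ≤ 1 := by
    have := logPlus_nonneg (√2 * x)
    refine sqrt_le_one.2 (sub_le_self _ ?_)
    positivity
  have hG : x ^ 2 / 2 * Psy s y x - Lsy s y x ≤ x ^ 2 / 2 - Lsy s y x + |K| := by
    have := mul_le_of_le_one_right (show 0 ≤ x ^ 2 / 2 by positivity) hP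
    linarith [abs_nonneg K]
  have h0 : 0 ≤ x ^ 2 / 2 - Lsy s y x + |K| := by linarith [hK x hx, le_abs_self K]
  have hTG : T * (x ^ 2 / 2 * Psy s y x - Lsy s y x) ≤ x ^ 2 / 2 - Lsy s y x + |K| :=
    (mul_le_mul_of_nonneg_left hG hT.1).trans (mul_le_of_le_one_left h0 hT.2)
  rw [← exp_add, exp_le_exp]
  linarith [mul_le_mul_of_nonneg_left hTG hκ.le]

/-! ### The weighted series -/

theorem exists_tsum_hermiteTerm_le {κ s y : ℝ} (β M : ℝ) (hκ : 0 < κ) (hs0 : 0 < s)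
    (hs1 : s < 1 / 2) (hy : 0 < y) :
    ∃ C : ℝ, 0 < C ∧ ∀ T ∈ Set.Icc (0 : ℝ) 1, ∀ x : ℝ, 1 < |x| →
      Summable (fun n : ℕ+ => hermiteTerm κ β s y x n) ∧
      ∑' n : ℕ+, hermiteTerm κ β s y x n ≤
        C * (|x| * logPlus (√2 * x) ^ (-M) *
          exp (-κ * T * (x ^ 2 / 2 * Psy s y x - Lsy s y x))) := by
  obtain ⟨C₁, hC₁, h₁⟩ := exists_exp_le hκ hs0 hs1 hy
  obtain ⟨C₂, hC₂, h₂⟩ := exists_logPlus_rpow_le M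
  have hsum : Summable fun n : ℕ+ => majorant κ β s y n :=
    (summable_majorant β hκ hs0 hs1 hy).comp_injective PNat.coe_injective
  have hS : 0 ≤ ∑' n : ℕ+, majorant κ β s y n :=
    tsum_nonneg fun n => by unfold majorant; positivity
  set S := ∑' n : ℕ+, majorant κ β s y n
  refine ⟨C₁ * C₂ * (S + 1), by positivity, fun T hT x hx => ?_⟩
  have hle (n : ℕ+) := hermiteTerm_le β hκ hs0 hs1 hy x n.pos
  have hsm : Summable fun n : ℕ+ => hermiteTerm κ β s y x n :=
    Summable.of_nonneg_of_le (fun n => hermiteTerm_nonneg κ β s y x n) hle (hsum.mul_left _)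
  refine ⟨hsm, ?_⟩
  have hl : 0 < logPlus (√2 * x) := by
    rw [logPlus, abs_mul, abs_of_nonneg (sqrt_nonneg 2)]
    exact log_pos (by have : 0 < √2 * |x| := by positivity
                      linarith)
  have hpre : 1 ≤ C₂ * (|x| * logPlus (√2 * x) ^ (-M)) := by
    rw [rpow_neg hl.le, ← mul_assoc, ← div_eq_mul_inv, one_le_div (by positivity)]
    exact h₂ x hx
  set G := exp (-κ * T * (x ^ 2 / 2 * Psy s y x - Lsy s y x))
  calc ∑' n : ℕ+, hermiteTerm κ β s y x n
      ≤ ∑' n : ℕ+, exp (-κ * (x ^ 2 / 2 - Lsy s y x)) * majorant κ β s y n :=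
        hsm.tsum_le_tsum hle (hsum.mul_left _)
    _ = exp (-κ * (x ^ 2 / 2 - Lsy s y x)) * S := tsum_mul_left
    _ ≤ C₁ * G * (S + 1) := by
        gcongr
        · exact h₁ T hT x hx
        · linarith
    _ ≤ C₁ * G * (S + 1) * (C₂ * (|x| * logPlus (√2 * x) ^ (-M))) :=
        le_mul_of_one_le_right (by positivity) hpre
    _ = _ := by ring

theorem theorem1p5 (κ β s : ℝ) (hκ : 0 < κ) (hs0 : 0 < s) (hs1 : s < 1 / 2) :
    (∀ y : ℝ, (2 : ℝ) ^ (1 / (2 * s) - 1) < y →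
      ∃ C : ℝ, 0 < C ∧ ∀ x : ℝ, 1 < |x| →
        Summable (fun n : ℕ+ => hermiteTerm κ β s y x n) ∧
        ∑' n : ℕ+, hermiteTerm κ β s y x n ≤
          C * (|x| * logPlus (Real.sqrt 2 * x) ^ (-(2 * s * (κ / 4 + β) / (1 - 2 * s))) *
            Real.exp (-κ * (x ^ 2 / 2 * Psy s y x - Lsy s y x)))) ∧
    (∀ y : ℝ, 0 < y → y ≤ (2 : ℝ) ^ (1 / (2 * s) - 1) →
      ∃ C : ℝ, 0 < C ∧ ∀ θ : ℝ → ℝ,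
        ContinuousOn θ (Set.Ioc 0 ((2 : ℝ) ^ (1 / (2 * s) - 1))) →
        (∀ r ∈ Set.Ioc (0 : ℝ) ((2 : ℝ) ^ (1 / (2 * s) - 1)),
          θ r ∈ Set.Icc (0 : ℝ) 1 ∧ θ r ≤ (2 * r) ^ (2 * s) / 2) →
        ∀ x : ℝ, 1 < |x| →
          Summable (fun n : ℕ+ => hermiteTerm κ β s y x n) ∧
          ∑' n : ℕ+, hermiteTerm κ β s y x n ≤
            C * (|x| * logPlus (Real.sqrt 2 * x) ^ (-(2 * s * (κ / 4 + β) / (1 - 2 * s))) *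
              Real.exp (-κ * θ y ^ (1 / (2 * s)) *
                (x ^ 2 / 2 * Psy s y x - Lsy s y x)))) := by
  have key (y : ℝ) (hy : 0 < y) :=
    exists_tsum_hermiteTerm_le β (2 * s * (κ / 4 + β) / (1 - 2 * s)) hκ hs0 hs1 hy
  constructor
  · intro y hy
    obtain ⟨C, hC, h⟩ := key y ((rpow_pos_of_pos two_pos _).trans hy)
    exact ⟨C, hC, fun x hx => by simpa using h 1 (by simp) x hx⟩
  · intro y hy hy'
    obtain ⟨C, hC, h⟩ := key y hy
    refine ⟨C, hC, fun θ _ hθ x hx => h _ ⟨?_, ?_⟩ x hx⟩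
    · exact rpow_nonneg (hθ y ⟨hy, hy'⟩).1.1 _
    · exact rpow_le_one (hθ y ⟨hy, hy'⟩).1.1 (hθ y ⟨hy, hy'⟩).1.2 (by positivity)
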